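/- Let $\mathcal X$ be a finite set with a probability measure $\mathrm P$ (defined on all subsets) and let $\mathcal R\subseteq 2^{\mathcal X}$ be a family of ranges. The VC-dimension of $(\mathcal X,\mathcal R)$ is the maximal size of a set $Y\subseteq\mathcal X$ with $\{R\cap Y: R\in\mathcal R\}=2^Y$ (and $0$ if $\mathcal R=\emptyset$). For $\epsilon>0$, an $\epsilon$-net is a set $S\subseteq \operatorname{supp}(\mathrm P)=\{x:\mathrm P(\{x\})>0\}$ that intersects every $R\in\mathcal R$ with $\mathrm P(R)\ge\epsilon$. Put $\mathcal R_{\le\delta}:=\{R\in\mathcal R:\mathrm P(R)\le\delta\}$. Alexander's capacity of $(\mathcal X,\mathcal R)$ is $$\tau(\epsilon):=\max\Big\{1,\ \sup_{\delta\ge\epsilon}\frac{\mathrm P\big(\bigcup_{R\in\mathcal R_{\le\delta}}R\big)}{\delta}\Big\}.$$ The doubling constant of $(\mathcal X,\mathcal R)$ at $\epsilon$ is $\sup_{\delta\ge\epsilon}\mathcal M(\mathcal R_{\le2\delta},\delta)$, where $\mathcal M(\mathcal F,\delta)$ is the largest size of a family $\mathcal Q\subseteq\mathcal F$ such that $\mathrm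 P(A\,\Delta\,B)\ge\delta$ for all distinct $A,B\in\mathcal Q$. There is an absolute constant $C>0$ such that the following holds for every such $(\mathcal X,\mathcal R)$ and $\mathrm P$, of VC-dimension $d$, every $\epsilon>0$, and every real number $D_\epsilon$ that is at least the doubling constant of $(\mathcal X,\mathcal R)$ at $\epsilon$. 1. If $D_\epsilon\ge e/\epsilon$, then there is an $\epsilon$-net for $(\mathcal X,\mathcal R)$ of size at most $$C\,\frac1\epsilon\big(d+\log(\epsilon D_\epsilon)\big).$$ 2. If $D_\epsilon\ge2\tau(\epsilon)$, then there is an $\epsilon$-net for $(\mathcal X,\mathcal R)$ of size at most $$C\,\tau(\epsilon)\Big(d+\log\frac{D_\epsilon}{\tau(\epsilon)}\Big)\max\Big\{1,\log\frac1\epsilon\Big\}.$$ -/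

import Mathlib

open MeasureTheory

noncomputable section

namespace RangeSpace

variable {X : Type*} [MeasurableSpace X]

/-- `S` is an `ε`-net for the range space with ranges `ℛ` and measure `P` on a finite ground set:
`S` lies in the support of `P` (the points of positive mass) and meets every range of
measure at least `ε`. -/
def IsNet (P : Measure X) (ℛ : Finset (Finset X)) (ε : ℝ) (S : Finset X) : Prop :=
  (∀ x ∈ S, 0 < P.real {x}) ∧
    ∀ R ∈ ℛ, ε ≤ P.real (R : Set X) → ∃ x ∈ S, x ∈ R

/-- The ranges of measure at most `δ`. -/
def lightRanges (P : Measure X) (ℛ : Finset (Finset X)) (δ : ℝ) : Finset (Finset X) :=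
  {R ∈ ℛ | P.real (R : Set X) ≤ δ}

/-- Alexander's capacity, truncated from below at `1`:
`max 1 (sup_{δ ≥ ε} P(⋃ {R ∈ ℛ : P R ≤ δ}) / δ)`. -/
def capacity (P : Measure X) (ℛ : Finset (Finset X)) (ε : ℝ) : ℝ :=
  max 1 (⨆ δ : Set.Ici ε, P.real (⋃ R ∈ lightRanges P ℛ δ, (R : Set X)) / (δ : ℝ))

/-- The distance `ρ(A, B) = P(A ∆ B)` between ranges. -/
def symmDist (P : Measure X) (A B : Finset X) : ℝ :=
  P.real (symmDiff (A : Set X) (B : Set X))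

/-- Distinct members of `𝒬` are at distance at least `δ` from each other. -/
def IsPacking (P : Measure X) (δ : ℝ) (𝒬 : Finset (Finset X)) : Prop :=
  ∀ A ∈ 𝒬, ∀ B ∈ 𝒬, A ≠ B → δ ≤ symmDist P A B

open scoped Classical in
/-- The packing number of `ℱ`: the largest size of a `δ`-packing contained in `ℱ`. -/
def packingNumber (P : Measure X) (ℱ : Finset (Finset X)) (δ : ℝ) : ℕ :=
  {𝒬 ∈ ℱ.powerset | IsPacking P δ 𝒬}.sup Finset.card

/-- The doubling constant: the supremum over `δ ≥ ε` of the packing number, at scale `δ`, of the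
family of ranges of measure at most `2 δ`. -/
def doublingConstant (P : Measure X) (ℛ : Finset (Finset X)) (ε : ℝ) : ℕ :=
  ⨆ δ : Set.Ici ε, packingNumber P (lightRanges P ℛ (2 * (δ : ℝ))) δ

/-- The supremum in `capacity` is that of a bounded set. -/
theorem bddAbove_capacity (P : Measure X) [IsProbabilityMeasure P] (ℛ : Finset (Finset X))
    {ε : ℝ} (hε : 0 < ε) :
    BddAbove (Set.range fun δ : Set.Ici ε =>
      P.real (⋃ R ∈ lightRanges P ℛ δ, (R : Set X)) / (δ : ℝ)) := by
  refine ⟨1 / ε, ?_⟩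
  rintro _ ⟨⟨δ, hδ⟩, rfl⟩
  exact div_le_div₀ zero_le_one measureReal_le_one hε hδ

open scoped Classical in
/-- The supremum in `doublingConstant` is that of a bounded set. -/
theorem bddAbove_doublingConstant (P : Measure X) (ℛ : Finset (Finset X)) (ε : ℝ) :
    BddAbove (Set.range fun δ : Set.Ici ε =>
      packingNumber P (lightRanges P ℛ (2 * (δ : ℝ))) δ) := by
  refine ⟨ℛ.card, ?_⟩
  rintro _ ⟨δ, rfl⟩
  refine Finset.sup_le fun 𝒬 h𝒬 => Finset.card_le_card ?_
  exact (Finset.mem_powerset.1 (Finset.mem_filter.1 h𝒬).1).trans (Finset.filter_subset _ _)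

end RangeSpace

end

/-! Split the ranges of measure at least `ε` into layers of measure between `δ` and `2 * δ`, with
`δ = 2 ^ i * ε`. A maximal `δ`-packing of a layer has at most `D` members, and, by maximality, every
range of the layer fills at least half of some member `Q`. So it suffices to hit, for each `Q`, the
traces filling half of `Q`. Double sampling bounds the probability that `m` points miss such a
trace by `exp (3 * d - P Q * m / 8)`. Traces on a double sample with `N` points in `Q` are counted
by the generating-function bound `t⁻¹ ^ d * (1 + t) ^ N`, which is multiplicative over the sample
points, so that it can be averaged exactly and the fluctuations of `N` do not matter.

Sample from the union `U` of the ranges of measure at most `2 * δ`, and choose `m` so that on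
average at most `exp (-d) * P U / δ` of the members `Q` are missed; give each of these its own net
of `O(d)` points. The layer then costs `P U / δ` times `d + log (D * δ / P U)` points, up to a
constant. With `P U ≤ 1` the sum over the layers is geometric; with `P U ≤ 2 * τ * δ` every layer
costs the same, and there are `O(log (1 / ε))` of them. -/

namespace RangeSpace

open Finset ProbabilityTheory

section Traces

variable {X ι : Type*} [DecidableEq X] [DecidableEq ι]

/-- The family of index sets that the ranges cut out of `J`, an index `i` standing for the point
`z i`. It covers both the restriction of `ℛ` to a set `Q`, as `traces ℛ Q id`, and the traces left
on a sample `z`, as `traces ℛ univ z`. -/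
def traces (ℛ : Finset (Finset X)) (J : Finset ι) (z : ι → X) : Finset (Finset ι) :=
  ℛ.image fun R => {i ∈ J | z i ∈ R}

theorem vcDim_traces_le (ℛ : Finset (Finset X)) (J : Finset ι) (z : ι → X) :
    (traces ℛ J z).vcDim ≤ ℛ.vcDim := by
  refine Finset.sup_le fun T hT => ?_
  rw [mem_shatterer] at hT
  have hTJ : T ⊆ J := by
    obtain ⟨A, hA, hTA⟩ := hT.exists_superset
    obtain ⟨R, -, rfl⟩ := mem_image.1 hA
    exact hTA.trans (filter_subset _ _)
  have hcut : ∀ U ⊆ T, ∃ R ∈ ℛ, ∀ i ∈ T, (z i ∈ R ↔ i ∈ U) := by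
    intro U hU
    obtain ⟨A, hA, rfl⟩ := hT hU
    obtain ⟨R, hR, rfl⟩ := mem_image.1 hA
    exact ⟨R, hR, fun i hi => by simp [hi, hTJ hi]⟩
  have hinj : Set.InjOn z T := by
    intro i hi j hj hij
    obtain ⟨R, -, hR⟩ := hcut {i} (singleton_subset_iff.2 hi)
    have hiR : z i ∈ R := (hR i hi).2 (mem_singleton_self i)
    exact (mem_singleton.1 ((hR j hj).1 (hij ▸ hiR))).symm
  rw [← card_image_of_injOn hinj]
  refine Shatters.card_le_vcDim fun V hV => ?_
  obtain ⟨R, hR, hRV⟩ := hcut {i ∈ T | z i ∈ V} (filter_subset _ _)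
  refine ⟨R, hR, Subset.antisymm (fun x hx => ?_) fun x hx => ?_⟩
  · obtain ⟨hxT, hxR⟩ := mem_inter.1 hx
    obtain ⟨i, hi, rfl⟩ := mem_image.1 hxT
    exact (mem_filter.1 ((hRV i hi).1 hxR)).2
  · obtain ⟨i, hi, rfl⟩ := mem_image.1 (hV hx)
    exact mem_inter.2 ⟨hV hx, (hRV i hi).2 (mem_filter.2 ⟨hi, hx⟩)⟩

/-- Sauer–Shelah, with the sum over sets of size at most `𝒜.vcDim` replaced by its
generating-function bound. -/
theorem card_le_inv_pow_vcDim_mul_one_add_pow {𝒜 : Finset (Finset ι)} {J : Finset ι}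
    (h𝒜 : ∀ A ∈ 𝒜, A ⊆ J) {t : ℝ} (ht : 0 < t) (ht1 : t ≤ 1) :
    (#𝒜 : ℝ) ≤ t⁻¹ ^ 𝒜.vcDim * (1 + t) ^ #J := by
  have hsub : 𝒜.shatterer ⊆ J.powerset := fun _ hT => by
    obtain ⟨A, hA, hTA⟩ := (mem_shatterer.1 hT).exists_superset
    exact mem_powerset.2 (hTA.trans (h𝒜 A hA))
  have hterm : ∀ T ∈ 𝒜.shatterer, 1 ≤ t⁻¹ ^ 𝒜.vcDim * t ^ #T := fun _ hT => by
    rw [inv_pow, ← div_eq_inv_mul, one_le_div (by positivity)]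
    exact pow_le_pow_of_le_one ht.le ht1 (mem_shatterer.1 hT).card_le_vcDim
  calc (#𝒜 : ℝ) ≤ #𝒜.shatterer := by exact_mod_cast card_le_card_shatterer 𝒜
    _ = ∑ _T ∈ 𝒜.shatterer, (1 : ℝ) := by simp
    _ ≤ ∑ T ∈ 𝒜.shatterer, t⁻¹ ^ 𝒜.vcDim * t ^ #T := sum_le_sum hterm
    _ ≤ ∑ T ∈ J.powerset, t⁻¹ ^ 𝒜.vcDim * t ^ #T :=
        sum_le_sum_of_subset_of_nonneg hsub fun _ _ _ => by positivity
    _ = t⁻¹ ^ 𝒜.vcDim * (1 + t) ^ #J := by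
        rw [← mul_sum, add_comm, ← sum_pow_mul_eq_add_pow]
        simp

theorem card_traces_univ_le [Fintype ι] {ℛ : Finset (Finset X)} {Q : Finset X}
    (hℛ : ∀ R ∈ ℛ, R ⊆ Q) (z : ι → X) {t : ℝ} (ht : 0 < t) (ht1 : t ≤ 1) :
    (#(traces ℛ univ z) : ℝ) ≤ t⁻¹ ^ ℛ.vcDim * ∏ i, (1 + if z i ∈ Q then t else 0) := by
  have hsub : ∀ A ∈ traces ℛ univ z, A ⊆ ({i | z i ∈ Q} : Finset ι) := by
    intro A hA
    obtain ⟨R, hR, rfl⟩ := mem_image.1 hA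
    exact monotone_filter_right _ fun i _ hi => hℛ R hR hi
  calc (#(traces ℛ univ z) : ℝ)
      ≤ t⁻¹ ^ (traces ℛ univ z).vcDim * (1 + t) ^ #{i | z i ∈ Q} :=
        card_le_inv_pow_vcDim_mul_one_add_pow hsub ht ht1
    _ ≤ t⁻¹ ^ ℛ.vcDim * (1 + t) ^ #{i | z i ∈ Q} := by
        gcongr
        · exact (one_le_inv₀ ht).2 ht1
        · exact vcDim_traces_le ℛ univ z
    _ = t⁻¹ ^ ℛ.vcDim * ∏ i, (1 + if z i ∈ Q then t else 0) := by
        rw [← prod_const, prod_filter]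
        exact congrArg _ (prod_congr rfl fun i _ => by split_ifs <;> simp)

end Traces

section DoubleSampling

variable {X ι : Type*}

/-- The sample `f` misses some range of `ℛ`. -/
def Misses (ℛ : Finset (Finset X)) (f : ι → X) : Prop :=
  ∃ R ∈ ℛ, ∀ i, f i ∉ R

/-- The double sample indexed by `ι × Bool` whose half selected by `σ` is `f` and whose other half
is `g`. -/
def merge (σ : ι → Bool) (f g : ι → X) (p : ι × Bool) : X :=
  if p.2 = σ p.1 then f p.1 else g p.1

variable [Fintype ι]

theorem prod_prod_bool_eq {M : Type*} [CommMonoid M] (φ : ι × Bool → M) (σ : ι → Bool) :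
    ∏ p, φ p = (∏ i, φ (i, σ i)) * ∏ i, φ (i, !σ i) := by
  rw [Fintype.prod_prod_type, ← prod_mul_distrib]
  refine prod_congr rfl fun i _ => ?_
  cases σ i <;> simp [mul_comm]

theorem measurePreserving_merge [MeasurableSpace X] (μ : Measure X) [SigmaFinite μ]
    (σ : ι → Bool) :
    MeasurePreserving (fun p : (ι → X) × (ι → X) => merge σ p.1 p.2)
      ((Measure.pi fun _ => μ).prod (Measure.pi fun _ => μ)) (Measure.pi fun _ => μ) := by
  have hmeas : Measurable fun p : (ι → X) × (ι → X) => merge σ p.1 p.2 :=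
    measurable_pi_lambda _ fun p => by unfold merge; split_ifs <;> fun_prop
  refine ⟨hmeas, (Measure.pi_eq fun s hs => ?_).symm⟩
  have hpre : (fun p : (ι → X) × (ι → X) => merge σ p.1 p.2) ⁻¹' Set.univ.pi s =
      (Set.univ.pi fun i => s (i, σ i)) ×ˢ Set.univ.pi fun i => s (i, !σ i) := by
    ext ⟨f, g⟩
    simp only [Set.mem_preimage, Set.mem_univ_pi, Set.mem_prod, Prod.forall, ← forall_and]
    refine forall_congr' fun i => ?_
    cases hσ : σ i <;> simp [merge, hσ, and_comm]
  rw [Measure.map_apply hmeas (.univ_pi hs), hpre, Measure.prod_prod, Measure.pi_pi,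
    Measure.pi_pi, prod_prod_bool_eq _ σ]

section SwapWeight

variable [DecidableEq ι]

/-- The weight of a set `T` of indices of a double sample under the swap `σ`: it vanishes when `T`
meets the half selected by `σ`, and otherwise is two to the power `#T`. -/
noncomputable def swapWeight (T : Finset (ι × Bool)) (σ : ι → Bool) : ℝ :=
  ∏ i, if (i, σ i) ∈ T then 0 else if (i, !σ i) ∈ T then 2 else 1

theorem swapWeight_nonneg (T : Finset (ι × Bool)) (σ : ι → Bool) : 0 ≤ swapWeight T σ :=
  prod_nonneg fun i _ => by split_ifs <;> norm_num

theorem sum_swapWeight_le (T : Finset (ι × Bool)) :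
    ∑ σ, swapWeight T σ ≤ 2 ^ Fintype.card ι := by
  calc ∑ σ, swapWeight T σ
      = ∏ i, ∑ b, if (i, b) ∈ T then (0 : ℝ) else if (i, !b) ∈ T then 2 else 1 :=
        (Fintype.prod_sum fun i b =>
          if (i, b) ∈ T then (0 : ℝ) else if (i, !b) ∈ T then 2 else 1).symm
    _ ≤ ∏ _i : ι, (2 : ℝ) := by
        refine prod_le_prod (fun i _ => sum_nonneg fun b _ => by split_ifs <;> norm_num)
          fun i _ => ?_
        rw [Fintype.sum_bool, Bool.not_true, Bool.not_false]
        split_ifs <;> norm_num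
    _ = 2 ^ Fintype.card ι := by simp

theorem swapWeight_merge [DecidableEq X] {R : Finset X} {f : ι → X} (hf : ∀ i, f i ∉ R) (g : ι → X)
    (σ : ι → Bool) :
    swapWeight {p | merge σ f g p ∈ R} σ = ∏ i, (1 + if g i ∈ R then 1 else 0) := by
  refine Fintype.prod_congr _ _ fun i => ?_
  have hsel : merge σ f g (i, σ i) = f i := by simp [merge]
  have hother : merge σ f g (i, !σ i) = g i := by simp [merge]
  simp only [mem_filter_univ, hsel, hother, hf, if_false]
  split_ifs <;> norm_num

end SwapWeight

variable [DecidableEq X] [MeasurableSpace X] [MeasurableSingletonClass X] [Finite X]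
  (μ : Measure X) [IsProbabilityMeasure μ]

theorem integral_pi_prod_one_add_ite (R : Finset X) (t : ℝ) :
    ∫ z : ι → X, ∏ i, (1 + if z i ∈ R then t else 0) ∂Measure.pi (fun _ => μ) =
      (1 + μ.real R * t) ^ Fintype.card ι := by
  rw [integral_fintype_prod_eq_pow fun x => 1 + if x ∈ R then t else 0]
  have hind : ∫ x, (if x ∈ R then t else 0) ∂μ = μ.real R * t := by
    rw [← smul_eq_mul, ← integral_indicator_const t R.measurableSet]
    exact integral_congr_ae (.of_forall fun x => by simp [Set.indicator])
  rw [integral_add .of_finite .of_finite, hind]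
  simp

/-- If the half of the double sample selected by `σ` misses `R`, the trace of `R` is weighted by
two to the number of points of `R` in the other half, whose mean is `(1 + μ R) ^ m`. -/
theorem one_add_pow_le_integral_sum_swapWeight [DecidableEq ι] {ℛ : Finset (Finset X)} {θ : ℝ}
    (hθ : 0 ≤ θ) (hℛ : ∀ R ∈ ℛ, θ ≤ μ.real R) {f : ι → X} (hf : Misses ℛ f) (σ : ι → Bool) :
    (1 + θ) ^ Fintype.card ι ≤
      ∫ g, ∑ T ∈ traces ℛ univ (merge σ f g), swapWeight T σ ∂Measure.pi (fun _ => μ) := by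
  obtain ⟨R, hR, hfR⟩ := hf
  calc (1 + θ) ^ Fintype.card ι
      ≤ (1 + μ.real R * 1) ^ Fintype.card ι := by
        rw [mul_one]
        gcongr
        exact hℛ R hR
    _ = ∫ g, ∏ i, (1 + if g i ∈ R then 1 else 0) ∂Measure.pi (fun _ => μ) :=
        (integral_pi_prod_one_add_ite μ R 1).symm
    _ ≤ ∫ g, ∑ T ∈ traces ℛ univ (merge σ f g), swapWeight T σ ∂Measure.pi (fun _ => μ) :=
        integral_mono .of_finite .of_finite fun g => by
          rw [← swapWeight_merge hfR g σ]
          exact single_le_sum (f := fun T => swapWeight T σ) (fun T _ => swapWeight_nonneg T σ)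
            (mem_image_of_mem _ hR)

theorem measureReal_misses_mul_le_integral [DecidableEq ι] {ℛ : Finset (Finset X)} {θ : ℝ}
    (hθ : 0 ≤ θ) (hℛ : ∀ R ∈ ℛ, θ ≤ μ.real R) (σ : ι → Bool) :
    (Measure.pi fun _ : ι => μ).real {f | Misses ℛ f} * (1 + θ) ^ Fintype.card ι ≤
      ∫ z, ∑ T ∈ traces ℛ univ z, swapWeight T σ ∂Measure.pi (fun _ => μ) := by
  rw [← (measurePreserving_merge μ σ).map_eq,
    integral_map (measurePreserving_merge μ σ).aemeasurable .of_discrete,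
    integral_prod _ .of_finite, ← smul_eq_mul, ← integral_indicator_const _ .of_discrete]
  refine integral_mono .of_finite .of_finite fun f => Set.indicator_apply_le' (fun hf => ?_)
    fun _ => integral_nonneg fun g => sum_nonneg fun T _ => swapWeight_nonneg T σ
  exact one_add_pow_le_integral_sum_swapWeight μ hθ hℛ hf σ

theorem measureReal_misses_mul_le {ℛ : Finset (Finset X)} {Q : Finset X} {θ t : ℝ} (hθ : 0 ≤ θ)
    (hℛ : ∀ R ∈ ℛ, R ⊆ Q ∧ θ ≤ μ.real R) (ht : 0 < t) (ht1 : t ≤ 1) :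
    (Measure.pi fun _ : ι => μ).real {f | Misses ℛ f} * (1 + θ) ^ Fintype.card ι ≤
      t⁻¹ ^ ℛ.vcDim * ((1 + μ.real Q * t) ^ 2) ^ Fintype.card ι := by
  classical
  set n := Fintype.card ι
  set p := (Measure.pi fun _ : ι => μ).real {f | Misses ℛ f}
  have hswap : ∀ z : ι × Bool → X, ∑ T ∈ traces ℛ univ z, ∑ σ, swapWeight T σ ≤
      2 ^ n * t⁻¹ ^ ℛ.vcDim * ∏ q, (1 + if z q ∈ Q then t else 0) := fun z =>
    calc ∑ T ∈ traces ℛ univ z, ∑ σ, swapWeight T σ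
        ≤ ∑ _T ∈ traces ℛ univ z, (2 : ℝ) ^ n := sum_le_sum fun T _ => sum_swapWeight_le T
      _ = 2 ^ n * #(traces ℛ univ z) := by rw [sum_const, nsmul_eq_mul, mul_comm]
      _ ≤ _ := by
        rw [mul_assoc]
        gcongr
        exact card_traces_univ_le (fun R hR => (hℛ R hR).1) z ht ht1
  refine le_of_mul_le_mul_left (a := (2 : ℝ) ^ n) ?_ (by positivity)
  calc 2 ^ n * (p * (1 + θ) ^ n)
      = ∑ _σ : ι → Bool, p * (1 + θ) ^ n := by simp [n]
    _ ≤ ∑ σ : ι → Bool, ∫ z, ∑ T ∈ traces ℛ univ z, swapWeight T σ ∂Measure.pi (fun _ => μ) :=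
        sum_le_sum fun σ _ => measureReal_misses_mul_le_integral μ hθ (fun R hR => (hℛ R hR).2) σ
    _ = ∫ z, ∑ T ∈ traces ℛ univ z, ∑ σ, swapWeight T σ ∂Measure.pi (fun _ => μ) := by
        rw [← integral_finsetSum _ fun _ _ => .of_finite]
        simp only [sum_comm (s := univ)]
    _ ≤ ∫ z, 2 ^ n * t⁻¹ ^ ℛ.vcDim * ∏ q, (1 + if z q ∈ Q then t else 0)
          ∂Measure.pi (fun _ : ι × Bool => μ) :=
        integral_mono .of_finite .of_finite hswap
    _ = 2 ^ n * (t⁻¹ ^ ℛ.vcDim * ((1 + μ.real Q * t) ^ 2) ^ n) := by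
        rw [integral_const_mul, integral_pi_prod_one_add_ite, Fintype.card_prod,
          Fintype.card_bool, mul_comm _ 2, pow_mul, mul_assoc]

theorem sixteen_le_exp_three : (16 : ℝ) ≤ Real.exp 3 := by
  calc (16 : ℝ) ≤ 2.7 ^ 3 := by norm_num
    _ ≤ Real.exp 1 ^ 3 := by
        gcongr
        linarith [Real.exp_one_gt_d9]
    _ = Real.exp 3 := by rw [← Real.exp_nat_mul]; norm_num

theorem measureReal_misses_le_exp {ℛ : Finset (Finset X)} {Q : Finset X}
    (hℛ : ∀ R ∈ ℛ, R ⊆ Q ∧ μ.real Q / 2 ≤ μ.real R) :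
    (Measure.pi fun _ : ι => μ).real {f | Misses ℛ f} ≤
      Real.exp (3 * ℛ.vcDim - μ.real Q / 8 * Fintype.card ι) := by
  set n := Fintype.card ι
  set q := μ.real (Q : Set X)
  have hq : 0 ≤ q := measureReal_nonneg
  have hq1 : q ≤ 1 := measureReal_le_one
  have hbase : (1 + q * (1 / 16)) ^ 2 ≤ Real.exp (-(q / 8)) * (1 + q / 2) :=
    calc (1 + q * (1 / 16)) ^ 2 ≤ (1 - q / 8) * (1 + q / 2) := by nlinarith
      _ ≤ Real.exp (-(q / 8)) * (1 + q / 2) := by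
        gcongr
        exact Real.one_sub_le_exp_neg _
  refine le_of_mul_le_mul_right (a := (1 + q / 2) ^ n) ?_ (by positivity)
  calc _ ≤ (1 / 16 : ℝ)⁻¹ ^ ℛ.vcDim * ((1 + q * (1 / 16)) ^ 2) ^ n :=
        measureReal_misses_mul_le μ (by positivity) hℛ (by norm_num) (by norm_num)
    _ ≤ Real.exp 3 ^ ℛ.vcDim * (Real.exp (-(q / 8)) * (1 + q / 2)) ^ n := by
        gcongr
        linarith [sixteen_le_exp_three]
    _ = Real.exp (3 * ℛ.vcDim - q / 8 * n) * (1 + q / 2) ^ n := by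
        rw [mul_pow, ← Real.exp_nat_mul, ← Real.exp_nat_mul, ← mul_assoc, ← Real.exp_add]
        ring_nf

end DoubleSampling

section HittingSets

theorem exists_card_filter_le_sum_measureReal {Ω α : Type*} [Finite Ω] [MeasurableSpace Ω]
    [MeasurableSingletonClass Ω] (ν : Measure Ω) [IsProbabilityMeasure ν] (𝒬 : Finset α)
    (E : α → Ω → Prop) [∀ ω, DecidablePred fun Q => E Q ω] :
    ∃ ω, ν {ω} ≠ 0 ∧ (#{Q ∈ 𝒬 | E Q ω} : ℝ) ≤ ∑ Q ∈ 𝒬, ν.real {ω | E Q ω} := by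
  have hnull : ν {ω | ν {ω} = 0} = 0 :=
    (measure_null_iff_singleton (Set.to_countable _)).2 fun _ hω => hω
  obtain ⟨ω, hω, hle⟩ := exists_notMem_null_le_integral
    (f := fun ω => ∑ Q ∈ 𝒬, {ω | E Q ω}.indicator (1 : Ω → ℝ) ω) .of_finite hnull
  refine ⟨ω, hω, ?_⟩
  rw [integral_finsetSum _ fun _ _ => .of_finite] at hle
  simp only [integral_indicator_one MeasurableSet.of_discrete] at hle
  simpa [Set.indicator_apply, sum_boole] using hle

variable {X : Type*} [MeasurableSpace X]

theorem pos_of_pi_singleton_ne_zero {ι : Type*} [Fintype ι] {μ : Measure X} [IsFiniteMeasure μ]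
    {f : ι → X} (hf : Measure.pi (fun _ => μ) {f} ≠ 0) (i : ι) : 0 < μ.real {f i} := by
  rw [Measure.pi_singleton, prod_ne_zero_iff] at hf
  exact ENNReal.toReal_pos (hf i (mem_univ i)) (measure_ne_top μ _)

theorem measureReal_pos_of_absolutelyContinuous {μ ν : Measure X} [IsFiniteMeasure μ]
    (h : ν ≪ μ) {s : Set X} (hs : 0 < ν.real s) : 0 < μ.real s :=
  measureReal_nonneg.lt_of_ne' fun hμs =>
    hs.ne' (by rw [measureReal_def, h ((measureReal_eq_zero_iff).1 hμs), ENNReal.toReal_zero])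

theorem cond_real_apply_of_subset (P : Measure X) {U A : Set X} (hU : MeasurableSet U)
    (hAU : A ⊆ U) : (P[|U]).real A = P.real A / P.real U := by
  rw [measureReal_def, cond_apply hU, Set.inter_eq_right.2 hAU, ENNReal.toReal_mul,
    ENNReal.toReal_inv, ← measureReal_def, ← measureReal_def, div_eq_inv_mul]

section MajorParts

variable [DecidableEq X] {μ : Measure X} {ℛ : Finset (Finset X)}

/-- The traces on `Q` of the ranges of `ℛ` that fill at least half of `Q`. -/
noncomputable def majorParts (μ : Measure X) (ℛ : Finset (Finset X)) (Q : Finset X) :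
    Finset (Finset X) :=
  {T ∈ traces ℛ Q id | μ.real Q / 2 ≤ μ.real T}

theorem vcDim_majorParts_le (μ : Measure X) (ℛ : Finset (Finset X)) (Q : Finset X) :
    (majorParts μ ℛ Q).vcDim ≤ ℛ.vcDim :=
  (vcDim_mono (filter_subset _ _)).trans (vcDim_traces_le ℛ Q id)

theorem subset_of_mem_majorParts {Q T : Finset X} (hT : T ∈ majorParts μ ℛ Q) : T ⊆ Q := by
  obtain ⟨R, -, rfl⟩ := mem_image.1 (mem_filter.1 hT).1
  exact filter_subset _ _

theorem half_measureReal_le_of_mem_majorParts {Q T : Finset X} (hT : T ∈ majorParts μ ℛ Q) :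
    μ.real Q / 2 ≤ μ.real T :=
  (mem_filter.1 hT).2

theorem inter_mem_majorParts {Q R : Finset X} (hR : R ∈ ℛ)
    (hQR : μ.real Q / 2 ≤ μ.real ((Q ∩ R : Finset X) : Set X)) : Q ∩ R ∈ majorParts μ ℛ Q :=
  mem_filter.2 ⟨mem_image.2 ⟨R, hR, filter_mem_eq_inter⟩, hQR⟩

end MajorParts

variable [MeasurableSingletonClass X] [Finite X] [DecidableEq X]

theorem exists_sample_card_disjoint_le (μ : Measure X) [IsProbabilityMeasure μ]
    {𝒬 : Finset (Finset X)} {ℱ : Finset X → Finset (Finset X)} {d : ℕ} {η : ℝ}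
    (hd : ∀ Q ∈ 𝒬, (ℱ Q).vcDim ≤ d) (hη : ∀ Q ∈ 𝒬, η ≤ μ.real Q)
    (hℱ : ∀ Q ∈ 𝒬, ∀ R ∈ ℱ Q, R ⊆ Q ∧ μ.real Q / 2 ≤ μ.real R) (m : ℕ) :
    ∃ S : Finset X, (∀ x ∈ S, 0 < μ.real {x}) ∧ #S ≤ m ∧
      (#{Q ∈ 𝒬 | ∃ R ∈ ℱ Q, Disjoint S R} : ℝ) ≤ #𝒬 * Real.exp (3 * d - η / 8 * m) := by
  classical
  obtain ⟨f, hf, hmiss⟩ := exists_card_filter_le_sum_measureReal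
    (Measure.pi fun _ : Fin m => μ) 𝒬 fun Q f => Misses (ℱ Q) f
  refine ⟨univ.image f, ?_, card_image_le.trans (by simp), ?_⟩
  · simpa using pos_of_pi_singleton_ne_zero hf
  calc (#{Q ∈ 𝒬 | ∃ R ∈ ℱ Q, Disjoint (univ.image f) R} : ℝ)
      = #{Q ∈ 𝒬 | Misses (ℱ Q) f} := Nat.cast_inj.2 <| congrArg card <|
        filter_congr fun Q _ => by simp [Misses, disjoint_left]
    _ ≤ ∑ Q ∈ 𝒬, (Measure.pi fun _ : Fin m => μ).real {f | Misses (ℱ Q) f} := hmiss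
    _ ≤ ∑ _Q ∈ 𝒬, Real.exp (3 * d - η / 8 * m) := by
        refine sum_le_sum fun Q hQ => (measureReal_misses_le_exp μ (hℱ Q hQ)).trans ?_
        rw [Fintype.card_fin]
        gcongr
        · exact hd Q hQ
        · exact hη Q hQ
    _ = #𝒬 * Real.exp (3 * d - η / 8 * m) := by rw [sum_const, nsmul_eq_mul]

theorem exists_half_net (P : Measure X) [IsFiniteMeasure P] {ℛ : Finset (Finset X)}
    {Q : Finset X} (hQ : 0 < P.real (Q : Set X))
    (hℛ : ∀ R ∈ ℛ, R ⊆ Q ∧ P.real Q / 2 ≤ P.real R) :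
    ∃ N : Finset X, (∀ x ∈ N, 0 < P.real {x}) ∧ (∀ R ∈ ℛ, ∃ x ∈ N, x ∈ R) ∧
      #N ≤ 24 * ℛ.vcDim + 1 := by
  have : IsProbabilityMeasure P[|Q] :=
    cond_isProbabilityMeasure ((measureReal_ne_zero_iff).1 hQ.ne')
  have hcondQ : (P[|Q]).real Q = 1 := by
    rw [cond_real_apply_of_subset P Q.measurableSet subset_rfl, div_self hQ.ne']
  have hcond : ∀ R ∈ ℛ, (P[|Q]).real Q / 2 ≤ (P[|Q]).real R := fun R hR => by
    rw [hcondQ, cond_real_apply_of_subset P Q.measurableSet (coe_subset.2 (hℛ R hR).1),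
      le_div_iff₀ hQ]
    linarith [(hℛ R hR).2]
  obtain ⟨N, hN, hcard, hmiss⟩ := exists_sample_card_disjoint_le P[|Q] (𝒬 := {Q})
    (ℱ := fun _ => ℛ) (d := ℛ.vcDim) (η := 1) (by simp) (by simp [hcondQ])
    (by
      simp only [mem_singleton, forall_eq]
      exact fun R hR => ⟨(hℛ R hR).1, hcond R hR⟩)
    (24 * ℛ.vcDim + 1)
  have hhit : ¬ ∃ R ∈ ℛ, Disjoint N R := fun h => by
    rw [filter_true_of_mem fun _ _ => h, card_singleton, Nat.cast_one, one_mul,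
      Real.one_le_exp_iff] at hmiss
    push_cast at hmiss
    linarith
  exact ⟨N, fun x hx => measureReal_pos_of_absolutelyContinuous cond_absolutelyContinuous (hN x hx),
    fun R hR => not_disjoint_iff.1 fun h => hhit ⟨R, hR, h⟩, hcard⟩

theorem exists_sample_card_majorParts_disjoint_mul_le (μ : Measure X) [IsProbabilityMeasure μ]
    (ℛ : Finset (Finset X)) {𝒬 : Finset (Finset X)} {η L : ℝ} (hη : 0 < η) (hL : 0 ≤ L)
    (hcard : η * #𝒬 ≤ Real.exp L) (h𝒬 : ∀ Q ∈ 𝒬, η ≤ μ.real Q) :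
    ∃ S : Finset X, (∀ x ∈ S, 0 < μ.real {x}) ∧ (#S : ℝ) ≤ 8 * (4 * ℛ.vcDim + L) / η + 1 ∧
      #{Q ∈ 𝒬 | ∃ T ∈ majorParts μ ℛ Q, Disjoint S T} * (24 * ℛ.vcDim + 1 : ℝ) ≤ 24 / η := by
  set d := ℛ.vcDim
  set m := ⌈8 * (4 * d + L) / η⌉₊
  obtain ⟨S, hS, hSm, hmiss⟩ := exists_sample_card_disjoint_le μ
    (fun Q _ => vcDim_majorParts_le μ ℛ Q) h𝒬
    (fun Q _ T hT => ⟨subset_of_mem_majorParts hT, half_measureReal_le_of_mem_majorParts hT⟩) m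
  have hm : 8 * (4 * d + L) ≤ m * η := (div_le_iff₀ hη).1 (Nat.le_ceil _)
  have hexp : Real.exp (-d) * (24 * d + 1) ≤ 24 := by
    rw [Real.exp_neg, inv_mul_le_iff₀ (Real.exp_pos _)]
    linarith [Real.add_one_le_exp (d : ℝ)]
  refine ⟨S, hS, (Nat.cast_le.2 hSm).trans (Nat.ceil_lt_add_one (by positivity)).le, ?_⟩
  rw [le_div_iff₀ hη]
  calc _ ≤ #𝒬 * Real.exp (3 * d - η / 8 * m) * (24 * d + 1) * η := by gcongr
    _ ≤ #𝒬 * Real.exp (-d - L) * (24 * d + 1) * η := by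
        gcongr _ * Real.exp ?_ * _ * _
        linarith
    _ = η * #𝒬 * Real.exp (-L) * (Real.exp (-d) * (24 * d + 1)) := by
        rw [sub_eq_add_neg, Real.exp_add]
        ring
    _ ≤ Real.exp L * Real.exp (-L) * 24 := by gcongr
    _ = 24 := by rw [← Real.exp_add, add_neg_cancel, Real.exp_zero, one_mul]

theorem exists_hitting_set (μ : Measure X) [IsProbabilityMeasure μ] {ℛ 𝒬 : Finset (Finset X)}
    {η L : ℝ} (hη : 0 < η) (hη1 : η ≤ 1) (hL : 1 / 2 ≤ L) (hcard : η * #𝒬 ≤ Real.exp L)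
    (h𝒬 : ∀ Q ∈ 𝒬, η ≤ μ.real Q)
    (hcov : ∀ R ∈ ℛ, ∃ Q ∈ 𝒬, μ.real Q / 2 ≤ μ.real ((Q ∩ R : Finset X) : Set X)) :
    ∃ S : Finset X, (∀ x ∈ S, 0 < μ.real {x}) ∧ (∀ R ∈ ℛ, ∃ x ∈ S, x ∈ R) ∧
      (#S : ℝ) ≤ 58 * ((ℛ.vcDim + L) / η) := by
  set d := ℛ.vcDim
  obtain ⟨S, hS, hSm, hmiss⟩ :=
    exists_sample_card_majorParts_disjoint_mul_le μ ℛ hη (by linarith) hcard h𝒬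
  set 𝒬' : Finset (Finset X) := {Q ∈ 𝒬 | ∃ T ∈ majorParts μ ℛ Q, Disjoint S T}
  have hnets : ∀ Q ∈ 𝒬, ∃ N : Finset X, (∀ x ∈ N, 0 < μ.real {x}) ∧
      (∀ T ∈ majorParts μ ℛ Q, ∃ x ∈ N, x ∈ T) ∧ #N ≤ 24 * d + 1 := fun Q hQ => by
    obtain ⟨N, hN, hhit, hNcard⟩ := exists_half_net μ (hη.trans_le (h𝒬 Q hQ))
      fun T (hT : T ∈ majorParts μ ℛ Q) =>
        ⟨subset_of_mem_majorParts hT, half_measureReal_le_of_mem_majorParts hT⟩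
    have hvc := vcDim_majorParts_le μ ℛ Q
    exact ⟨N, hN, hhit, by lia⟩
  choose! N hN hNhit hNcard using hnets
  have hunion : #(S ∪ 𝒬'.biUnion N) ≤ #S + #𝒬' * (24 * d + 1) :=
    (card_union_le _ _).trans <| Nat.add_le_add_left
      (card_biUnion_le_card_mul _ _ _ fun Q hQ => hNcard Q (mem_filter.1 hQ).1) _
  refine ⟨S ∪ 𝒬'.biUnion N, fun x hx => ?_, fun R hR => ?_, ?_⟩
  · rcases mem_union.1 hx with hx | hx
    · exact hS x hx
    · obtain ⟨Q, hQ, hxQ⟩ := mem_biUnion.1 hx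
      exact hN Q (mem_filter.1 hQ).1 x hxQ
  · obtain ⟨Q, hQ, hQR⟩ := hcov R hR
    have hmaj := inter_mem_majorParts hR hQR
    by_cases hdisj : Disjoint S (Q ∩ R)
    · obtain ⟨x, hx, hxR⟩ := hNhit Q hQ _ hmaj
      exact ⟨x, mem_union_right _ (mem_biUnion.2 ⟨Q, mem_filter.2 ⟨hQ, _, hmaj, hdisj⟩, hx⟩),
        (mem_inter.1 hxR).2⟩
    · obtain ⟨x, hx, hxR⟩ := not_disjoint_iff.1 hdisj
      exact ⟨x, mem_union_left _ hx, (mem_inter.1 hxR).2⟩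
  · calc (#(S ∪ 𝒬'.biUnion N) : ℝ) ≤ #S + #𝒬' * (24 * d + 1) := by exact_mod_cast hunion
      _ ≤ 8 * (4 * d + L) / η + 1 / η + 24 / η := by
          gcongr
          exact hSm.trans (by gcongr; exact (one_le_div hη).2 hη1)
      _ = (8 * (4 * d + L) + 25) / η := by ring
      _ ≤ 58 * (d + L) / η := by
          gcongr
          linarith [Nat.cast_nonneg (α := ℝ) d]
      _ = 58 * ((d + L) / η) := by ring

theorem exists_hitting_set_of_subset (P : Measure X) [IsFiniteMeasure P] {U : Set X}
    (hU : MeasurableSet U) (hPU : 0 < P.real U) {ℛ 𝒬 : Finset (Finset X)} {η L : ℝ} (hη : 0 < η)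
    (hη1 : η ≤ 1) (hL : 1 / 2 ≤ L) (hcard : η * #𝒬 ≤ Real.exp L)
    (h𝒬 : ∀ Q ∈ 𝒬, (Q : Set X) ⊆ U ∧ η * P.real U ≤ P.real Q)
    (hcov : ∀ R ∈ ℛ, ∃ Q ∈ 𝒬, P.real Q / 2 ≤ P.real ((Q ∩ R : Finset X) : Set X)) :
    ∃ S : Finset X, (∀ x ∈ S, 0 < P.real {x}) ∧ (∀ R ∈ ℛ, ∃ x ∈ S, x ∈ R) ∧
      (#S : ℝ) ≤ 58 * ((ℛ.vcDim + L) / η) := by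
  have : IsProbabilityMeasure P[|U] :=
    cond_isProbabilityMeasure ((measureReal_ne_zero_iff).1 hPU.ne')
  have hcond : ∀ Q ∈ 𝒬, ∀ A ⊆ Q, (P[|U]).real A = P.real A / P.real U := fun Q hQ A hA =>
    cond_real_apply_of_subset P hU ((coe_subset.2 hA).trans (h𝒬 Q hQ).1)
  have hmass : ∀ Q ∈ 𝒬, η ≤ (P[|U]).real Q := fun Q hQ => by
    rw [hcond Q hQ Q Subset.rfl, le_div_iff₀ hPU]
    exact (h𝒬 Q hQ).2
  have hhalf : ∀ R ∈ ℛ, ∃ Q ∈ 𝒬,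
      (P[|U]).real Q / 2 ≤ (P[|U]).real ((Q ∩ R : Finset X) : Set X) := fun R hR => by
    obtain ⟨Q, hQ, hQR⟩ := hcov R hR
    refine ⟨Q, hQ, ?_⟩
    rw [hcond Q hQ Q Subset.rfl, hcond Q hQ _ inter_subset_left, div_right_comm]
    gcongr
  obtain ⟨S, hS, hhit, hScard⟩ := exists_hitting_set P[|U] hη hη1 hL hcard hmass hhalf
  exact ⟨S, fun x hx =>
    measureReal_pos_of_absolutelyContinuous cond_absolutelyContinuous (hS x hx), hhit, hScard⟩

end HittingSets

section Layers

variable {X : Type*} [MeasurableSpace X]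

/-- The ranges of measure between `δ` and `2 * δ`. The ranges of measure at least `ε` are split
into the layers at the scales `2 ^ i * ε`, which are treated separately. -/
noncomputable def layer (P : Measure X) (ℛ : Finset (Finset X)) (δ : ℝ) : Finset (Finset X) :=
  {R ∈ ℛ | δ ≤ P.real R ∧ P.real R ≤ 2 * δ}

theorem layer_subset_lightRanges (P : Measure X) (ℛ : Finset (Finset X)) (δ : ℝ) :
    layer P ℛ δ ⊆ lightRanges P ℛ (2 * δ) :=
  monotone_filter_right _ fun _ _ hR => hR.2

theorem symmDist_comm (P : Measure X) (A B : Finset X) : symmDist P A B = symmDist P B A := by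
  rw [symmDist, symmDist, symmDiff_comm]

theorem IsPacking.card_le {P : Measure X} {δ : ℝ} {ℱ 𝒬 : Finset (Finset X)}
    (h : IsPacking P δ 𝒬) (hsub : 𝒬 ⊆ ℱ) : #𝒬 ≤ packingNumber P ℱ δ := by
  classical
  exact le_sup (f := Finset.card) (mem_filter.2 ⟨mem_powerset.2 hsub, h⟩)

theorem IsPacking.insert [DecidableEq X] {P : Measure X} {δ : ℝ} {𝒬 : Finset (Finset X)}
    {R : Finset X} (h : IsPacking P δ 𝒬) (hR : ∀ Q ∈ 𝒬, δ ≤ symmDist P R Q) :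
    IsPacking P δ (insert R 𝒬) := by
  intro A hA B hB hAB
  rcases mem_insert.1 hA with rfl | hA' <;> rcases mem_insert.1 hB with rfl | hB'
  · exact absurd rfl hAB
  · exact hR B hB'
  · exact symmDist_comm P A B ▸ hR A hA'
  · exact h A hA' B hB' hAB

theorem exists_maximal_packing (P : Measure X) (ℱ : Finset (Finset X)) (δ : ℝ) :
    ∃ 𝒬 ⊆ ℱ, IsPacking P δ 𝒬 ∧ ∀ R ∈ ℱ, R ∉ 𝒬 → ∃ Q ∈ 𝒬, symmDist P R Q < δ := by
  classical
  obtain ⟨𝒬, h𝒬, hmax⟩ := exists_max_image {𝒬 ∈ ℱ.powerset | IsPacking P δ 𝒬} Finset.card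
    ⟨∅, mem_filter.2 ⟨empty_mem_powerset _, fun A hA => absurd hA (notMem_empty A)⟩⟩
  obtain ⟨hsub, hpack⟩ := mem_filter.1 h𝒬
  rw [mem_powerset] at hsub
  refine ⟨𝒬, hsub, hpack, fun R hR hR𝒬 => ?_⟩
  by_contra! hfar
  have hcard := hmax (insert R 𝒬)
    (mem_filter.2 ⟨mem_powerset.2 (insert_subset hR hsub), hpack.insert hfar⟩)
  rw [card_insert_of_notMem hR𝒬] at hcard
  lia

theorem packingNumber_le_doublingConstant (P : Measure X) (ℛ : Finset (Finset X)) {ε δ : ℝ}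
    (h : ε ≤ δ) : packingNumber P (lightRanges P ℛ (2 * δ)) δ ≤ doublingConstant P ℛ ε :=
  le_ciSup (bddAbove_doublingConstant P ℛ ε) (⟨δ, h⟩ : Set.Ici ε)

theorem one_le_capacity (P : Measure X) (ℛ : Finset (Finset X)) (ε : ℝ) :
    1 ≤ capacity P ℛ ε := le_max_left _ _

theorem measureReal_le_capacity_mul (P : Measure X) [IsProbabilityMeasure P]
    (ℛ : Finset (Finset X)) {ε δ : ℝ} (hε : 0 < ε) (h : ε ≤ δ) :
    P.real (⋃ R ∈ lightRanges P ℛ δ, (R : Set X)) ≤ capacity P ℛ ε * δ := by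
  rw [← div_le_iff₀ (hε.trans_le h)]
  exact (le_ciSup (bddAbove_capacity P ℛ hε) (⟨δ, h⟩ : Set.Ici ε)).trans (le_max_right _ _)

theorem exists_dyadic_scale {ε a : ℝ} (hε : 0 < ε) (ha : ε ≤ a) {n : ℕ} (hn : a < 2 ^ n * ε) :
    ∃ i < n, 2 ^ i * ε ≤ a ∧ a ≤ 2 * (2 ^ i * ε) := by
  obtain ⟨i, hi, hi'⟩ := exists_nat_pow_near ((one_le_div hε).2 ha) one_lt_two
  rw [le_div_iff₀ hε] at hi
  rw [div_lt_iff₀ hε] at hi'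
  refine ⟨i, ?_, hi, by rw [pow_succ] at hi'; linarith⟩
  exact (pow_lt_pow_iff_right₀ one_lt_two).1 (lt_of_mul_lt_mul_right (hi.trans_lt hn) hε.le)

theorem exists_dyadic_count {ε : ℝ} (hε : 0 < ε) :
    ∃ n : ℕ, 1 < 2 ^ n * ε ∧ (n : ℝ) ≤ 3 * max 1 (Real.log (1 / ε)) := by
  set M := max 1 (Real.log (1 / ε))
  have hM : 1 ≤ M := le_max_left _ _
  refine ⟨⌊2 * M⌋₊ + 1, ?_, ?_⟩
  · have hlog : M < (⌊2 * M⌋₊ + 1 : ℕ) * Real.log 2 := by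
      have hfloor := Nat.lt_floor_add_one (2 * M)
      push_cast
      nlinarith [Real.log_two_gt_d9]
    rw [← div_lt_iff₀ hε, ← Real.log_lt_log_iff (by positivity) (by positivity), Real.log_pow]
    exact (le_max_right _ _).trans_lt hlog
  · push_cast
    linarith [Nat.floor_le (show 0 ≤ 2 * M by positivity)]

theorem exists_isNet_of_layers (P : Measure X) [IsProbabilityMeasure P] {ℛ : Finset (Finset X)}
    {ε : ℝ} (hε : 0 < ε) {n : ℕ} (hn : 1 < 2 ^ n * ε) {b : ℕ → ℝ}
    (h : ∀ i, ∃ S : Finset X, (∀ x ∈ S, 0 < P.real {x}) ∧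
      (∀ R ∈ layer P ℛ (2 ^ i * ε), ∃ x ∈ S, x ∈ R) ∧ (#S : ℝ) ≤ b i) :
    ∃ S : Finset X, IsNet P ℛ ε S ∧ (#S : ℝ) ≤ ∑ i ∈ range n, b i := by
  classical
  choose S hS hhit hcard using h
  refine ⟨(range n).biUnion S, ⟨fun x hx => ?_, fun R hR hεR => ?_⟩, ?_⟩
  · obtain ⟨i, -, hxi⟩ := mem_biUnion.1 hx
    exact hS i x hxi
  · obtain ⟨i, hi, hlow, hupp⟩ := exists_dyadic_scale hε hεR (measureReal_le_one.trans_lt hn)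
    obtain ⟨x, hx, hxR⟩ := hhit i R (mem_filter.2 ⟨hR, hlow, hupp⟩)
    exact ⟨x, mem_biUnion.2 ⟨i, mem_range.2 hi, hx⟩, hxR⟩
  · calc (#((range n).biUnion S) : ℝ) ≤ ∑ i ∈ range n, (#(S i) : ℝ) := by
          exact_mod_cast card_biUnion_le
      _ ≤ ∑ i ∈ range n, b i := sum_le_sum fun i _ => hcard i

theorem sum_add_div_two_pow_le {a : ℝ} (ha : 0 ≤ a) (n : ℕ) :
    ∑ i ∈ range n, (a + i) / 2 ^ i ≤ 2 * a + 2 := by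
  have hsum : ∑ i ∈ range n, (a + i) / 2 ^ i = 2 * a + 2 - (2 * a + 2 * n + 2) / 2 ^ n := by
    induction n with
    | zero => simp
    | succ k ih =>
      rw [sum_range_succ, ih, pow_succ]
      push_cast
      field_simp
      ring
  rw [hsum]
  exact sub_le_self _ (by positivity)

variable [MeasurableSingletonClass X] [DecidableEq X]

theorem symmDist_add_two_mul_measureReal_inter (P : Measure X) [IsFiniteMeasure P]
    (A B : Finset X) :
    symmDist P A B + 2 * P.real ((A ∩ B : Finset X) : Set X) = P.real A + P.real B := by
  have hA := measureReal_inter_add_sdiff (μ := P) (s := (A : Set X)) B.measurableSet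
  have hB := measureReal_inter_add_sdiff (μ := P) (s := (B : Set X)) A.measurableSet
  rw [Set.inter_comm] at hB
  rw [symmDist, measureReal_symmDiff_eq (μ := P) A.measurableSet B.measurableSet, coe_inter]
  linarith

theorem exists_layer_cover (P : Measure X) [IsFiniteMeasure P] (ℛ : Finset (Finset X)) (δ : ℝ) :
    ∃ 𝒬 ⊆ layer P ℛ δ, #𝒬 ≤ packingNumber P (lightRanges P ℛ (2 * δ)) δ ∧
      ∀ R ∈ layer P ℛ δ, ∃ Q ∈ 𝒬, P.real Q / 2 ≤ P.real ((Q ∩ R : Finset X) : Set X) := by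
  obtain ⟨𝒬, hsub, hpack, hmax⟩ := exists_maximal_packing P (layer P ℛ δ) δ
  refine ⟨𝒬, hsub, hpack.card_le (hsub.trans (layer_subset_lightRanges P ℛ δ)), fun R hR => ?_⟩
  by_cases hR𝒬 : R ∈ 𝒬
  · refine ⟨R, hR𝒬, ?_⟩
    rw [inter_self]
    exact half_le_self measureReal_nonneg
  · obtain ⟨Q, hQ, hRQ⟩ := hmax R hR hR𝒬
    refine ⟨Q, hQ, ?_⟩
    have hδR : δ ≤ P.real R := (mem_filter.1 hR).2.1
    rw [inter_comm]
    linarith [symmDist_add_two_mul_measureReal_inter P R Q]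

theorem exists_layer_hitting_set [Finite X] (P : Measure X) [IsFiniteMeasure P]
    {ℛ : Finset (Finset X)} {δ η L : ℝ} (hδ : 0 < δ) (hη : 0 < η) (hL : 1 / 2 ≤ L)
    (hmass : η * P.real (⋃ R ∈ lightRanges P ℛ (2 * δ), (R : Set X)) ≤ δ)
    (hcard : η * packingNumber P (lightRanges P ℛ (2 * δ)) δ ≤ Real.exp L) :
    ∃ S : Finset X, (∀ x ∈ S, 0 < P.real {x}) ∧ (∀ R ∈ layer P ℛ δ, ∃ x ∈ S, x ∈ R) ∧
      (#S : ℝ) ≤ 58 * ((ℛ.vcDim + L) / η) := by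
  rcases (layer P ℛ δ).eq_empty_or_nonempty with hempty | ⟨R₀, hR₀⟩
  · refine ⟨∅, by simp, by simp [hempty], ?_⟩
    rw [card_empty, Nat.cast_zero]
    positivity
  set U := ⋃ R ∈ lightRanges P ℛ (2 * δ), (R : Set X) with hU
  clear_value U
  have hsubU : ∀ R ∈ layer P ℛ δ, (R : Set X) ⊆ U := fun R hR =>
    hU ▸ Set.subset_biUnion_of_mem (u := fun R : Finset X => (R : Set X))
      (layer_subset_lightRanges P ℛ δ hR)
  have hδU : δ ≤ P.real U := (mem_filter.1 hR₀).2.1.trans (measureReal_mono (hsubU R₀ hR₀))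
  have hη1 : η ≤ 1 :=
    le_of_mul_le_mul_right (hmass.trans (by rwa [one_mul])) (hδ.trans_le hδU)
  obtain ⟨𝒬, h𝒬, h𝒬card, hcov⟩ := exists_layer_cover P ℛ δ
  obtain ⟨S, hS, hhit, hScard⟩ := exists_hitting_set_of_subset P U.toFinite.measurableSet
    (hδ.trans_le hδU) hη hη1 hL (le_trans (by gcongr) hcard)
    (fun Q hQ => ⟨hsubU Q (h𝒬 hQ), hmass.trans (mem_filter.1 (h𝒬 hQ)).2.1⟩) hcov
  refine ⟨S, hS, hhit, hScard.trans ?_⟩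
  gcongr
  exact filter_subset _ _

variable [Finite X] (P : Measure X) [IsProbabilityMeasure P]
  {ℛ : Finset (Finset X)} {ε D : ℝ}

theorem exists_isNet_of_doublingConstant_le (hε : 0 < ε) (hD : doublingConstant P ℛ ε ≤ D)
    (hDε : Real.exp 1 / ε ≤ D) :
    ∃ S : Finset X, IsNet P ℛ ε S ∧
      (#S : ℝ) ≤ 232 * (1 / ε * (ℛ.vcDim + Real.log (ε * D))) := by
  set d := ℛ.vcDim
  obtain ⟨n, hn, -⟩ := exists_dyadic_count hε
  have hεD : Real.exp 1 ≤ ε * D := (div_le_iff₀' hε).1 hDε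
  have hεD0 : 0 < ε * D := (Real.exp_pos 1).trans_le hεD
  have hlog : 1 ≤ Real.log (ε * D) := (Real.le_log_iff_exp_le hεD0).2 hεD
  have hpack : ∀ i : ℕ,
      2 ^ i * ε * packingNumber P (lightRanges P ℛ (2 * (2 ^ i * ε))) (2 ^ i * ε) ≤
        Real.exp (Real.log (ε * D) + i) := fun i =>
    calc _ ≤ 2 ^ i * ε * D := by
          gcongr
          refine (Nat.cast_le.2 (packingNumber_le_doublingConstant P ℛ ?_)).trans hD
          exact le_mul_of_one_le_left hε.le (one_le_pow₀ one_le_two)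
      _ = ε * D * 2 ^ i := by ring
      _ ≤ ε * D * Real.exp 1 ^ i := by
          gcongr
          linarith [Real.add_one_le_exp 1]
      _ = Real.exp (Real.log (ε * D) + i) := by
          rw [Real.exp_add, Real.exp_log hεD0, Real.exp_one_pow]
  obtain ⟨S, hS, hcard⟩ := exists_isNet_of_layers P hε hn fun i =>
    exists_layer_hitting_set P (by positivity) (by positivity)
      (hlog.trans' (by norm_num) |>.trans (le_add_of_nonneg_right i.cast_nonneg))
      (mul_le_of_le_one_right (by positivity) measureReal_le_one) (hpack i)
  refine ⟨S, hS, hcard.trans ?_⟩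
  calc ∑ i ∈ range n, 58 * ((d + (Real.log (ε * D) + i)) / (2 ^ i * ε))
      = 58 / ε * ∑ i ∈ range n, (d + Real.log (ε * D) + i) / 2 ^ i := by
        rw [mul_sum]
        exact sum_congr rfl fun i _ => by field_simp; ring
    _ ≤ 58 / ε * (2 * (d + Real.log (ε * D)) + 2) := by
        gcongr
        exact sum_add_div_two_pow_le (by positivity) n
    _ ≤ 58 / ε * (4 * (d + Real.log (ε * D))) := by
        gcongr
        linarith [Nat.cast_nonneg (α := ℝ) d]
    _ = 232 * (1 / ε * (d + Real.log (ε * D))) := by ring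

theorem exists_isNet_of_two_mul_capacity_le (hε : 0 < ε) (hD : doublingConstant P ℛ ε ≤ D)
    (hDτ : 2 * capacity P ℛ ε ≤ D) :
    ∃ S : Finset X, IsNet P ℛ ε S ∧
      (#S : ℝ) ≤ 348 * (capacity P ℛ ε * (ℛ.vcDim + Real.log (D / capacity P ℛ ε)) *
        max 1 (Real.log (1 / ε))) := by
  set d := ℛ.vcDim
  set τ := capacity P ℛ ε
  obtain ⟨n, hn, hn'⟩ := exists_dyadic_count hε
  have hτ : 0 < τ := zero_lt_one.trans_le (one_le_capacity P ℛ ε)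
  have hDτ2 : 2 ≤ D / τ := (le_div_iff₀ hτ).2 hDτ
  have hlog : 1 / 2 ≤ Real.log (D / τ) := by
    linarith [Real.log_two_gt_d9, Real.log_le_log two_pos hDτ2]
  have hscale : ∀ i : ℕ, ε ≤ 2 ^ i * ε := fun i =>
    le_mul_of_one_le_left hε.le (one_le_pow₀ one_le_two)
  have hmass : ∀ i : ℕ,
      1 / (2 * τ) * P.real (⋃ R ∈ lightRanges P ℛ (2 * (2 ^ i * ε)), (R : Set X)) ≤
        2 ^ i * ε := fun i => by
    rw [one_div, inv_mul_le_iff₀ (by positivity)]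
    linarith [measureReal_le_capacity_mul P ℛ hε
      (show ε ≤ 2 * (2 ^ i * ε) by linarith [hscale i])]
  have hpack : ∀ i : ℕ,
      1 / (2 * τ) * packingNumber P (lightRanges P ℛ (2 * (2 ^ i * ε))) (2 ^ i * ε) ≤
        Real.exp (Real.log (D / τ)) := fun i =>
    calc _ ≤ 1 / τ * D := by
          gcongr
          · linarith
          · exact (Nat.cast_le.2 (packingNumber_le_doublingConstant P ℛ (hscale i))).trans hD
      _ = Real.exp (Real.log (D / τ)) := by rw [Real.exp_log (by linarith), one_div_mul_eq_div]
  obtain ⟨S, hS, hcard⟩ := exists_isNet_of_layers P hε hn fun i =>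
    exists_layer_hitting_set P (by positivity) (by positivity) hlog (hmass i) (hpack i)
  refine ⟨S, hS, hcard.trans ?_⟩
  calc ∑ _i ∈ range n, 58 * ((d + Real.log (D / τ)) / (1 / (2 * τ)))
      = n * (116 * (τ * (d + Real.log (D / τ)))) := by
        rw [sum_const, card_range, nsmul_eq_mul, div_div_eq_mul_div, div_one]
        ring
    _ ≤ 3 * max 1 (Real.log (1 / ε)) * (116 * (τ * (d + Real.log (D / τ)))) := by gcongr
    _ = 348 * (τ * (d + Real.log (D / τ)) * max 1 (Real.log (1 / ε))) := by ring

end Layers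

end RangeSpace

theorem corollary5 :
    ∃ C : ℝ, 0 < C ∧
      ∀ (X : Type*) [Fintype X] [DecidableEq X] [MeasurableSpace X] [MeasurableSingletonClass X]
        (P : MeasureTheory.Measure X) [MeasureTheory.IsProbabilityMeasure P]
        (ℛ : Finset (Finset X)) (d : ℕ) (ε D : ℝ),
        ℛ.vcDim = d → 0 < ε → (RangeSpace.doublingConstant P ℛ ε : ℝ) ≤ D →
        (Real.exp 1 / ε ≤ D →
          ∃ S : Finset X, RangeSpace.IsNet P ℛ ε S ∧
            (S.card : ℝ) ≤ C * (1 / ε * (d + Real.log (ε * D)))) ∧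
        (2 * RangeSpace.capacity P ℛ ε ≤ D →
          ∃ S : Finset X, RangeSpace.IsNet P ℛ ε S ∧
            (S.card : ℝ) ≤ C * (RangeSpace.capacity P ℛ ε *
              (d + Real.log (D / RangeSpace.capacity P ℛ ε)) *
              max 1 (Real.log (1 / ε)))) := by
  refine ⟨348, by norm_num, ?_⟩
  rintro X _ _ _ _ P _ ℛ _ ε D rfl hε hD
  refine ⟨fun hDε => ?_, RangeSpace.exists_isNet_of_two_mul_capacity_le P hε hD⟩
  obtain ⟨S, hS, hcard⟩ := RangeSpace.exists_isNet_of_doublingConstant_le P hε hD hDε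
  refine ⟨S, hS, hcard.trans (mul_le_mul_of_nonneg_right (by norm_num) ?_)⟩
  linarith [(Nat.cast_nonneg (α := ℝ) S.card).trans hcard]
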